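/- All rings are associative with identity $1\neq 0$, not necessarily commutative, and subrings contain the identity of the ring. A ring $T$ is *integral over its center* $C(T)$ if every $t\in T$ satisfies an equation $t^n+c_{n-1}t^{n-1}+\cdots+c_1t+c_0=0$ with $n\ge 1$ and $c_0,\dots,c_{n-1}\in C(T)$. A *maximal subring* of $T$ is a subring $R\subsetneq T$ such that there is no subring $S$ of $T$ with $R\subsetneq S\subsetneq T$. **Theorem.** Let $\{T_i\}_{i\in I}$ be a family of rings indexed by an infinite set $I$, and let $T=\prod_{i\in I}T_i$ be their direct product. Then the following hold: 1. If each $T_i$ is integral over its center, then $T$ has a maximal subring. 2. If $T$ is integral over its center, then $T$ has a maximal subring. -/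

import Mathlib

/-- A ring `T` is integral over its center: every `t : T` is a root of a monic polynomial with
coefficients in the center `C(T)`. -/
def IsIntegralOverCenter (T : Type*) [Ring T] : Prop :=
  (Subring.center T).subtype.IsIntegral

/-- `R` is a maximal subring of `T`: a proper (unital) subring such that there is no subring
strictly between `R` and `T`. -/
def IsMaximalSubring {T : Type*} [Ring T] (R : Subring T) : Prop :=
  R ≠ ⊤ ∧ ∀ S : Subring T, R ≤ S → S = R ∨ S = ⊤

/-! Maximal subrings pull back along surjections, so it suffices to find one in some quotient of the
product. In particular the second claim reduces to the first, since each factor is a quotient of the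
product.

Replace each factor by a simple quotient, still integral over its center. If one of these is not a
field, it contains a nontrivial idempotent or is a noncommutative division ring. In both cases it is
finitely generated over a proper subring, and Zorn's lemma (`HasMaximalSubring.of_finite`) applies.

If all are fields and two are isomorphic, the diagonal of `K × K` does the job. If no two are
isomorphic, the product has a unit `a` with no positive power equal to 1, and some residue field
keeps `a` of infinite order. Such a field is algebraic over a UFD with a prime `x`, hence generated
by `x⁻¹` over a proper subring. -/

/-- A ring has a maximal subring. -/
def HasMaximalSubring (T : Type*) [Ring T] : Prop :=
  ∃ R : Subring T, IsMaximalSubring R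

/-! ### Quotients and finite generation -/

theorem HasMaximalSubring.of_surjective {T S : Type*} [Ring T] [Ring S] (f : T →+* S)
    (hf : Function.Surjective f) (h : HasMaximalSubring S) : HasMaximalSubring T := by
  obtain ⟨R, hR, hmax⟩ := h
  refine ⟨R.comap f, fun htop => hR ?_, fun S' hS' => ?_⟩
  · rw [eq_top_iff]
    intro s _
    obtain ⟨t, rfl⟩ := hf s
    exact Subring.mem_comap.1 (htop ▸ Subring.mem_top t)
  -- `S'` contains the kernel of `f`, so it is recovered from its image.
  · have hcm : (S'.map f).comap f = S' := by
      refine le_antisymm (fun t ht => ?_) (fun t ht => ⟨t, ht, rfl⟩)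
      obtain ⟨u, hu, hut⟩ := Subring.mem_map.1 (Subring.mem_comap.1 ht)
      have hker : t - u ∈ S' := hS' (by
        rw [Subring.mem_comap, map_sub, hut, sub_self]; exact R.zero_mem)
      simpa using S'.add_mem hker hu
    have hle : R ≤ S'.map f := by
      intro s hs
      obtain ⟨t, rfl⟩ := hf s
      exact ⟨t, hS' (Subring.mem_comap.2 hs), rfl⟩
    rcases hmax _ hle with h | h
    · left; rw [← hcm, h]
    · right; rw [← hcm, h, Subring.comap_top]

/-- A ring which is finitely generated over a proper subring has a maximal subring. -/
theorem HasMaximalSubring.of_finite {T : Type*} [Ring T] (R : Subring T) (hR : R ≠ ⊤)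
    (s : Set T) (hs : s.Finite) (h : Subring.closure (R ∪ s) = ⊤) : HasMaximalSubring T := by
  have hgen : ∀ S : Subring T, R ≤ S → s ⊆ S → S = ⊤ := fun S h1 h2 =>
    top_le_iff.1 (h ▸ (Subring.closure_le.2 (Set.union_subset h1 h2)))
  -- Since `s` is finite, a chain whose union contains `s` has a member containing `s`.
  obtain ⟨M, hRM, hM⟩ := zorn_le_nonempty₀ {S : Subring T | R ≤ S ∧ ¬ s ⊆ S} (by
    intro c hc hchain y hy
    refine ⟨sSup c, ⟨(hc hy).1.trans (le_sSup hy), fun hsub => ?_⟩, fun z hz => le_sSup hz⟩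
    have hdir : DirectedOn (fun i j : Subring T => (i : Set T) ⊆ j) c := hchain.directedOn
    have hdir' : DirectedOn (· ≤ ·) c := hchain.directedOn
    obtain ⟨i, hi, hsi⟩ := hdir.exists_mem_subset_of_finset_subset_biUnion ⟨y, hy⟩
      (s := hs.toFinset) (by
        intro t ht
        obtain ⟨S, hS, htS⟩ := (Subring.mem_sSup_of_directedOn ⟨y, hy⟩ hdir').1
          (hsub (by simpa using ht))
        exact Set.mem_biUnion hS htS)
    exact (hc hi).2 (by simpa using hsi)) R ⟨le_rfl, fun hsub => hR (hgen R le_rfl hsub)⟩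
  refine ⟨M, ?_, fun S hS => ?_⟩
  · rintro rfl
    exact hM.prop.2 (fun _ _ => Subring.mem_top _)
  · by_cases hsS : s ⊆ S
    · exact Or.inr (hgen S (hRM.trans hS) hsS)
    · exact Or.inl (le_antisymm (hM.le_of_ge ⟨hRM.trans hS, hsS⟩ hS) hS)

/-! ### Simple rings and idempotents -/

theorem IsSimpleRing.one_mem_closure_mul_mul {S : Type*} [Ring S] [IsSimpleRing S] {a : S}
    (ha : a ≠ 0) : (1 : S) ∈ AddSubgroup.closure {z | ∃ x y, z = x * a * y} := by
  have h1 := IsSimpleRing.one_mem_of_ne_zero_mem (TwoSidedIdeal.span {a}) ha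
    (TwoSidedIdeal.subset_span rfl)
  rw [TwoSidedIdeal.mem_span_iff_mem_addSubgroup_closure] at h1
  refine AddSubgroup.closure_mono ?_ h1
  rintro z hz
  simp only [Set.mem_mul, Set.mem_univ, true_and, Set.mem_singleton_iff] at hz
  aesop

/-- The diagonal is a maximal subring of the square of a simple ring. -/
theorem hasMaximalSubring_prod_self (S : Type*) [Ring S] [IsSimpleRing S] :
    HasMaximalSubring (S × S) := by
  refine ⟨((RingHom.id S).prod (RingHom.id S)).range, fun htop => ?_, fun R hR => ?_⟩
  · have h : ((0, 1) : S × S) ∈ ((RingHom.id S).prod (RingHom.id S)).range :=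
      htop ▸ Subring.mem_top _
    obtain ⟨x, hx⟩ := h
    simp only [RingHom.prod_apply, RingHom.id_apply, Prod.mk.injEq] at hx
    exact zero_ne_one (hx.1.symm.trans hx.2)
  · have hdiag : ∀ x : S, (x, x) ∈ R := fun x => hR ⟨x, rfl⟩
    by_cases h : ∃ p ∈ R, p.1 ≠ p.2
    · right
      obtain ⟨⟨a, b⟩, hp, hab⟩ := h
      have hd : (a - b, (0 : S)) ∈ R := by
        simpa using R.sub_mem hp (hdiag b)
      have hone : ((1 : S), (0 : S)) ∈ R := by
        refine AddSubgroup.closure_induction (p := fun z _ => (z, (0 : S)) ∈ R) ?_ ?_ ?_ ?_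
          (IsSimpleRing.one_mem_closure_mul_mul (sub_ne_zero.2 hab))
        · rintro _ ⟨x, y, rfl⟩
          simpa using R.mul_mem (R.mul_mem (hdiag x) hd) (hdiag y)
        · exact R.zero_mem
        · intro x y _ _ hx hy
          simpa using R.add_mem hx hy
        · intro x _ hx
          simpa using R.neg_mem hx
      rw [eq_top_iff]
      rintro ⟨x, y⟩ _
      simpa using R.add_mem (R.mul_mem (hdiag (x - y)) hone) (hdiag y)
    · left
      push Not at h
      refine le_antisymm (fun p hp => ⟨p.1, ?_⟩) hR
      exact Prod.ext rfl (h p hp)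

/-- Every nontrivial ring has a simple quotient. -/
theorem exists_isSimpleRing_quotient (T : Type*) [Ring T] [Nontrivial T] :
    ∃ (I : Ideal T) (_ : I.IsTwoSided), IsSimpleRing (T ⧸ I) := by
  obtain ⟨M, -, hM⟩ := zorn_le_nonempty₀ {I : Ideal T | I.IsTwoSided ∧ (1 : T) ∉ I} (by
    intro c hc hchain y hy
    have hdir : DirectedOn (· ≤ ·) c := hchain.directedOn
    refine ⟨sSup c, ⟨⟨fun {a} b ha => ?_⟩, fun h1 => ?_⟩, fun z hz => le_sSup hz⟩
    · obtain ⟨J, hJ, haJ⟩ := (Submodule.mem_sSup_of_directed ⟨y, hy⟩ hdir).1 ha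
      have := (hc hJ).1
      exact (le_sSup hJ : J ≤ sSup c) (Ideal.mul_mem_right b J haJ)
    · obtain ⟨J, hJ, h1J⟩ := (Submodule.mem_sSup_of_directed ⟨y, hy⟩ hdir).1 h1
      exact (hc hJ).2 h1J) ⊥ ⟨inferInstance, by simp⟩
  have hM2 : M.IsTwoSided := hM.prop.1
  have hM1 : M ≠ ⊤ := fun h => hM.prop.2 (h ▸ Submodule.mem_top)
  refine ⟨M, hM2, isSimpleRing_iff_isTwoSided_imp.2 ⟨Ideal.Quotient.nontrivial_iff.2 hM1,
    fun J hJ => ?_⟩⟩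
  have hle : M ≤ J.comap (Ideal.Quotient.mk M) := by
    intro x hx
    rw [Ideal.mem_comap, Ideal.Quotient.eq_zero_iff_mem.2 hx]
    exact J.zero_mem
  by_cases h1 : (1 : T) ∈ J.comap (Ideal.Quotient.mk M)
  · right
    rw [Ideal.eq_top_iff_one]
    simpa using h1
  · left
    have hle' := hM.le_of_ge (y := J.comap (Ideal.Quotient.mk M))
      ⟨⟨fun {a} b ha => by
        rw [Ideal.mem_comap, map_mul]
        exact J.mul_mem_right _ ha⟩, h1⟩ hle
    rw [eq_bot_iff]
    intro x hx
    obtain ⟨t, rfl⟩ := Ideal.Quotient.mk_surjective x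
    exact Ideal.Quotient.eq_zero_iff_mem.2 (hle' hx)

/-- A simple ring with a nontrivial idempotent has a maximal subring. -/
theorem HasMaximalSubring.of_isIdempotentElem {S : Type*} [Ring S] [IsSimpleRing S] {e : S}
    (he : IsIdempotentElem e) (h0 : e ≠ 0) (h1 : e ≠ 1) : HasMaximalSubring S := by
  have hee : e * e = e := he
  have hfe : (1 - e) * e = 0 := by rw [sub_mul, one_mul, hee, sub_self]
  -- The block triangular elements of the Peirce decomposition; only the corner `(1 - e) S e` is
  -- missing.
  let R : Subring S :=
    { carrier := {x | (1 - e) * x * e = 0}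
      mul_mem' := by
        intro x y (hx : _ = _) (hy : _ = _)
        have hx' : (1 - e) * x = (1 - e) * x * (1 - e) := by
          rw [mul_sub, mul_one, hx, sub_zero]
        calc (1 - e) * (x * y) * e = ((1 - e) * x) * y * e := by noncomm_ring
          _ = ((1 - e) * x * (1 - e)) * y * e := by rw [← hx']
          _ = (1 - e) * x * ((1 - e) * y * e) := by simp only [mul_assoc]
          _ = 0 := by rw [hy, mul_zero]
      one_mem' := by simpa using hfe
      add_mem' := by
        intro x y (hx : _ = _) (hy : _ = _)
        change (1 - e) * (x + y) * e = 0
        rw [mul_add, add_mul, hx, hy, add_zero]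
      zero_mem' := by simp
      neg_mem' := by
        intro x (hx : _ = _)
        change (1 - e) * (-x) * e = 0
        rw [mul_neg, neg_mul, hx, neg_zero] }
  have memR : ∀ x, x ∈ R ↔ (1 - e) * x * e = 0 := fun x => Iff.rfl
  have hone := IsSimpleRing.one_mem_closure_mul_mul h0
  -- The factor 1 is kept so that it can be expanded as a finite sum of terms `± x * e * y`; each
  -- costs one new generator, `(1 - e) * x * e`.
  have hgen : ∃ s : Set S, s.Finite ∧
      ∀ t, (1 - e) * 1 * ((1 - e) * t * e) ∈ Subring.closure ((R : Set S) ∪ s) := by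
    refine AddSubgroup.closure_induction (p := fun z _ => ∃ s : Set S, s.Finite ∧
      ∀ t, (1 - e) * z * ((1 - e) * t * e) ∈ Subring.closure ((R : Set S) ∪ s)) ?_ ?_ ?_ ?_ hone
    · rintro _ ⟨x, y, rfl⟩
      refine ⟨{(1 - e) * x * e}, Set.finite_singleton _, fun t => ?_⟩
      have h2 : e * y * (1 - e) * t * e ∈ R := by
        rw [memR]
        simp only [← mul_assoc, hfe, zero_mul]
      have h3 : (1 - e) * (x * e * y) * ((1 - e) * t * e) =
          ((1 - e) * x * e) * (e * y * (1 - e) * t * e) := by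
        have : ((1 - e) * x * e) * (e * y * (1 - e) * t * e) =
          ((1 - e) * x * (e * e)) * (y * (1 - e) * t * e) := by simp only [mul_assoc]
        rw [this, hee]; simp only [mul_assoc]
      rw [h3]
      exact Subring.mul_mem _ (Subring.subset_closure (Or.inr rfl))
        (Subring.subset_closure (Or.inl h2))
    · exact ⟨∅, Set.finite_empty, fun t => by simp⟩
    · rintro x y _ _ ⟨s, hs, hx⟩ ⟨s', hs', hy⟩
      refine ⟨s ∪ s', hs.union hs', fun t => ?_⟩
      rw [mul_add, add_mul]
      exact Subring.add_mem _
        (Subring.closure_mono (Set.union_subset_union_right _ Set.subset_union_left) (hx t))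
        (Subring.closure_mono (Set.union_subset_union_right _ Set.subset_union_right) (hy t))
    · rintro x _ ⟨s, hs, hx⟩
      refine ⟨s, hs, fun t => ?_⟩
      rw [mul_neg, neg_mul]
      exact Subring.neg_mem _ (hx t)
  obtain ⟨s, hs, hgen⟩ := hgen
  refine .of_finite R (fun htop => ?_) s hs ?_
  · have hall : ∀ x, (1 - e) * x * e = 0 := fun x => (memR x).1 (htop ▸ Subring.mem_top x)
    have : (1 - e) * 1 = 0 := by
      refine AddSubgroup.closure_induction (p := fun z _ => (1 - e) * z = 0) ?_ ?_ ?_ ?_ hone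
      · rintro _ ⟨x, y, rfl⟩
        rw [← mul_assoc, ← mul_assoc, hall, zero_mul]
      · simp
      · intro x y _ _ hx hy
        rw [mul_add, hx, hy, add_zero]
      · intro x _ hx
        rw [mul_neg, hx, neg_zero]
    rw [mul_one, sub_eq_zero] at this
    exact h1 this.symm
  · rw [eq_top_iff]
    intro x _
    have hff : (1 - e) * (1 - e) = 1 - e := by rw [mul_sub, mul_one, hfe, sub_zero]
    have h2 : (1 - e) * 1 * ((1 - e) * x * e) = (1 - e) * x * e := by
      rw [mul_one, mul_assoc (1 - e) x, ← mul_assoc, hff]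
    have h3 : x - (1 - e) * x * e ∈ R := by
      rw [memR, mul_sub, sub_mul, mul_assoc (1 - e) x, ← mul_assoc (1 - e) (1 - e), hff,
        mul_assoc (1 - e) (x * e) e, mul_assoc x, hee, sub_self]
    have h4 : x - (1 - e) * x * e ∈ Subring.closure ((R : Set S) ∪ s) :=
      Subring.subset_closure (Or.inl h3)
    have := Subring.add_mem _ h4 (hgen x)
    rw [h2] at this
    simpa using this
-- From simple rings to division rings
open Polynomial in
/-- In a ring without nontrivial idempotents, an element algebraic over a field is nilpotent or a unit. -/
theorem isNilpotent_or_isUnit_of_isAlgebraic {K S : Type*} [Field K] [Ring S] [Algebra K S]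
    (hS : ∀ e : S, IsIdempotentElem e → e = 0 ∨ e = 1) {a : S} (ha : IsAlgebraic K a) :
    IsNilpotent a ∨ IsUnit a := by
  obtain ⟨p, hp, hpa⟩ := ha
  obtain ⟨q, hq, hXq⟩ := Polynomial.exists_eq_pow_rootMultiplicity_mul_and_not_dvd p hp 0
  rw [C_0, sub_zero] at hq hXq
  set k := rootMultiplicity 0 p
  have hcop : IsCoprime (X ^ k) q :=
    ((Polynomial.irreducible_X.coprime_iff_not_dvd).2 hXq).pow_left
  -- Bézout for `p = X ^ k * q` splits 1 into two idempotents with product zero, one of which must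
  -- vanish.
  obtain ⟨u, v, huv⟩ := hcop
  have h1 : aeval a u * a ^ k + aeval a v * aeval a q = 1 := by
    simpa using congrArg (aeval a) huv
  have h2 : a ^ k * aeval a q = 0 := by
    rw [hq] at hpa
    simpa using hpa
  have hc : ∀ r : K[X], Commute a (aeval a r) := fun r => by
    simpa using (Commute.all (X : K[X]) r).map (aeval a)
  have hck : ∀ r : K[X], Commute (a ^ k) (aeval a r) := fun r => (hc r).pow_left k
  have hvq : Commute (aeval a v) (aeval a q) := (Commute.all v q).map (aeval a)
  have h3 : aeval a v * aeval a q * (aeval a u * a ^ k) = 0 := by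
    have : aeval a v * aeval a q * (aeval a u * a ^ k) = aeval a (v * u) * (a ^ k * aeval a q) := by
      rw [← map_mul, ← (hck u).eq, ← mul_assoc, ← (hck (v * q)).eq, mul_assoc, ← map_mul,
        show v * q * u = v * u * q by ring, map_mul _ (v * u) q, ← mul_assoc, (hck (v * u)).eq,
        mul_assoc]
    rw [this, h2, mul_zero]
  have hid : IsIdempotentElem (aeval a u * a ^ k) := by
    have h4 : aeval a v * aeval a q = 1 - aeval a u * a ^ k := by rw [← h1]; abel
    rw [h4, sub_mul, one_mul, sub_eq_zero] at h3
    exact h3.symm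
  rcases hS _ hid with h0 | h0
  · left
    rw [h0, zero_add] at h1
    refine ⟨k, ?_⟩
    calc a ^ k = a ^ k * (aeval a v * aeval a q) := by rw [h1, mul_one]
      _ = a ^ k * aeval a q * aeval a v := by rw [hvq.eq, mul_assoc]
      _ = 0 := by rw [h2, zero_mul]
  · right
    rcases Nat.eq_zero_or_pos k with hk | hk
    · rw [hk, pow_zero, one_mul] at h2
      rw [h2, mul_zero, add_zero, hk, pow_zero, mul_one] at h1
      have hX : IsCoprime X q := (Polynomial.irreducible_X.coprime_iff_not_dvd).2 hXq
      obtain ⟨u', v', h'⟩ := hX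
      have h5 : aeval a u' * a = 1 := by simpa [h2] using congrArg (aeval a) h'
      exact isUnit_iff_exists.2 ⟨_, (hc u').eq.trans h5, h5⟩
    · obtain ⟨m, hm⟩ := Nat.exists_eq_add_of_lt hk
      have h5 : aeval a u * a ^ m * a = 1 := by
        rw [mul_assoc, ← pow_succ]
        simpa [hm] using h0
      refine isUnit_iff_exists.2 ⟨aeval a u * a ^ m, ?_, h5⟩
      rw [← h5]
      exact ((hc u).mul_right ((Commute.refl a).pow_right m)).eq

/-- A simple ring in which every element is nilpotent or a unit is a division ring. -/
theorem IsSimpleRing.isUnit_of_isNilpotent_or_isUnit {S : Type*} [Ring S] [IsSimpleRing S]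
    (h : ∀ a : S, IsNilpotent a ∨ IsUnit a) {a : S} (ha : a ≠ 0) : IsUnit a := by
  have not_unit : ∀ {b : S}, IsNilpotent b → ¬ IsUnit b := fun hb hu =>
    hb.not_isUnit hu
  have mul_left : ∀ {b : S} (x : S), IsNilpotent b → IsNilpotent (x * b) := by
    intro b x hb
    refine (h _).resolve_right fun hu => ?_
    obtain ⟨w, hw, hw'⟩ := isUnit_iff_exists.1 hu
    obtain ⟨n, hn⟩ := hb
    have : ∀ m, (w * x) ^ m * b ^ m = 1 := by
      intro m
      induction m with
      | zero => simp
      | succ m ih =>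
        rw [pow_succ, pow_succ', mul_assoc, ← mul_assoc (w * x) b, mul_assoc w, hw', one_mul, ih]
    have := this n
    rw [hn, mul_zero] at this
    exact zero_ne_one this
  have mul_right : ∀ {b : S} (x : S), IsNilpotent b → IsNilpotent (b * x) := by
    intro b x hb
    refine (h _).resolve_right fun hu => ?_
    obtain ⟨w, hw, hw'⟩ := isUnit_iff_exists.1 hu
    obtain ⟨n, hn⟩ := hb
    have : ∀ m, b ^ m * (x * w) ^ m = 1 := by
      intro m
      induction m with
      | zero => simp
      | succ m ih =>
        rw [pow_succ, pow_succ', mul_assoc, ← mul_assoc b, ← mul_assoc b, hw, one_mul, ih]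
    have := this n
    rw [hn, zero_mul] at this
    exact zero_ne_one this
  have add : ∀ {b c : S}, IsNilpotent b → IsNilpotent c → IsNilpotent (b + c) := by
    intro b c hb hc
    refine (h _).resolve_right fun hu => ?_
    obtain ⟨w, hw, hw'⟩ := isUnit_iff_exists.1 hu
    -- If `w` inverts `b + c`, then `1 - w * c = w * b` is both a unit and nilpotent.
    have h1 : IsUnit (1 - w * c) := (mul_left w hc).isUnit_one_sub
    have h2 : 1 - w * c = w * b := by rw [← hw', mul_add]; abel
    rw [h2] at h1
    exact not_unit (mul_left w hb) h1
  refine (h a).resolve_left fun hn => ?_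
  have h1 : IsNilpotent (1 : S) := by
    refine AddSubgroup.closure_induction (p := fun z _ => IsNilpotent z) ?_ ?_ ?_ ?_
      (IsSimpleRing.one_mem_closure_mul_mul ha)
    · rintro _ ⟨x, y, rfl⟩
      exact mul_right y (mul_left x hn)
    · exact IsNilpotent.zero
    · intro x y _ _ hx hy
      exact add hx hy
    · intro x _ hx
      exact hx.neg
  exact not_unit h1 isUnit_one

/-! ### Noncommutative division rings -/

open Polynomial in
/-- A noncommutative division ring algebraic over its center has a maximal subring: it is finitely
generated over the centralizer of any element. -/
theorem HasMaximalSubring.of_not_mem_center {D : Type*} [DivisionRing D] {a : D}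
    (ha : a ∉ Subring.center D) (hint : IsIntegral (Subring.center D) a) :
    HasMaximalSubring D := by
  set K := Subring.center D with hK
  set Z := Subring.centralizer {a} with hZ
  -- A polynomial with coefficients `wᵢ` encodes the operator `d ↦ ∑ wᵢ d aⁱ`.
  let φ : D[X] → D → D := fun w d => (w * C d).eval a
  have hφ_add : ∀ w w' d, φ (w + w') d = φ w d + φ w' d := fun w w' d => by
    simp [φ, add_mul]
  have hφ_left : ∀ x w d, φ (C x * w) d = x * φ w d := fun x w d => by
    simp only [φ, mul_assoc, eval_C_mul]
  have hφ_right : ∀ x w d, φ (w * C x) d = φ w (x * d) := fun x w d => by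
    simp only [φ, mul_assoc, ← C_mul]
  have hφ_X : ∀ w d, φ (X * w) d = φ w d * a := fun w d => by
    simp only [φ, mul_assoc]
    rw [X_mul, eval_mul_X]
  let P : D[X] → Prop := fun w => ∃ s : Set D, s.Finite ∧
    ∀ d, φ w d ∈ Subring.closure ((Z : Set D) ∪ s)
  have hP_add : ∀ w w', P w → P w' → P (w + w') := by
    rintro w w' ⟨s, hs, h⟩ ⟨s', hs', h'⟩
    refine ⟨s ∪ s', hs.union hs', fun d => ?_⟩
    rw [hφ_add]
    exact Subring.add_mem _
      (Subring.closure_mono (Set.union_subset_union_right _ Set.subset_union_left) (h d))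
      (Subring.closure_mono (Set.union_subset_union_right _ Set.subset_union_right) (h' d))
  have hP_left : ∀ x w, P w → P (C x * w) := by
    rintro x w ⟨s, hs, h⟩
    refine ⟨insert x s, hs.insert x, fun d => ?_⟩
    rw [hφ_left]
    exact Subring.mul_mem _ (Subring.subset_closure (Or.inr (Set.mem_insert x s)))
      (Subring.closure_mono (Set.union_subset_union_right _ (Set.subset_insert x s)) (h d))
  have hP_right : ∀ x w, P w → P (w * C x) := by
    rintro x w ⟨s, hs, h⟩
    exact ⟨s, hs, fun d => by rw [hφ_right]; exact h _⟩
  -- the quotient of the minimal polynomial by `X - a`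
  set f := minpoly K a with hf
  have hfm : f.Monic := minpoly.monic hint
  have hdvd : ∀ p : K[X], (X - C a : D[X]) ∣ p.map (algebraMap K D) - C (aeval a p) := by
    intro p
    induction p using Polynomial.induction_on' with
    | add p q hp hq =>
      have := dvd_add hp hq
      rw [map_add, Polynomial.map_add, C_add]
      convert this using 1
      abel
    | monomial n c =>
      have hcomm : Commute (X : D[X]) (C a) := X_mul_C a
      obtain ⟨q, hq⟩ := hcomm.sub_dvd_pow_sub_pow n
      refine ⟨q * C (algebraMap K D c), ?_⟩
      rw [← mul_assoc, ← hq, sub_mul, aeval_monomial, map_monomial, ← C_pow, ← C_mul,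
        X_pow_mul_C, C_mul_X_pow_eq_monomial, Algebra.commutes]
  obtain ⟨b, hb⟩ := hdvd f
  rw [minpoly.aeval, C_0, sub_zero] at hb
  have hb0 : b ≠ 0 := by
    rintro rfl
    rw [mul_zero] at hb
    exact (hfm.map (algebraMap K D)).ne_zero hb
  have hbdeg : b.natDegree < f.natDegree := by
    have := congrArg natDegree hb
    rw [(monic_X_sub_C a).natDegree_mul' hb0, natDegree_X_sub_C, hfm.natDegree_map] at this
    omega
  have hφf : ∀ (p : K[X]) d, φ (p.map (algebraMap K D)) d = d * aeval a p := by
    intro p d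
    induction p using Polynomial.induction_on' with
    | add p q hp hq => rw [Polynomial.map_add, hφ_add, hp, hq, map_add, mul_add]
    | monomial n c =>
      simp only [φ, map_monomial, monomial_mul_C, eval_monomial, aeval_monomial]
      rw [Algebra.commutes, mul_assoc]
  -- The operator of `f = (X - a) * b` is zero, so the values of the operator of `b` commute with
  -- `a`.
  have hPb : P b := by
    refine ⟨∅, Set.finite_empty, fun d => Subring.subset_closure (Or.inl ?_)⟩
    have h1 : φ ((X - C a) * b) d = φ b d * a - a * φ b d := by
      have h2 := hφ_add ((X - C a) * b) (C a * b) d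
      rw [← add_mul, sub_add_cancel, hφ_X, hφ_left] at h2
      rw [h2, add_sub_cancel_right]
    rw [← hb, hφf, minpoly.aeval, mul_zero] at h1
    rw [hZ, SetLike.mem_coe, Subring.mem_centralizer_iff]
    rintro _ rfl
    exact (sub_eq_zero.1 h1.symm).symm
  -- a nonzero polynomial of minimal degree with `P`
  obtain ⟨w, ⟨hw0, hPw⟩, hmin⟩ := WellFounded.has_min (measure (natDegree : D[X] → ℕ)).wf
    {w | w ≠ 0 ∧ P w} ⟨b, hb0, hPb⟩
  have hwdeg : w.natDegree < f.natDegree :=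
    (not_lt.1 (hmin b ⟨hb0, hPb⟩)).trans_lt hbdeg
  obtain ⟨w', hw'm, hw'P, hw'deg⟩ : ∃ w' : D[X], w'.Monic ∧ P w' ∧ w'.natDegree = w.natDegree := by
    have hl : w.leadingCoeff⁻¹ ≠ 0 := inv_ne_zero (leadingCoeff_ne_zero.2 hw0)
    refine ⟨C w.leadingCoeff⁻¹ * w, ?_, hP_left _ _ hPw, natDegree_C_mul hl⟩
    rw [Monic, leadingCoeff_mul, leadingCoeff_C, inv_mul_cancel₀ (leadingCoeff_ne_zero.2 hw0)]
  -- The commutator with a constant keeps `P` but loses the leading term, so minimality kills it and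
  -- the coefficients are central.
  have hcent : ∀ x, C x * w' = w' * C x := by
    intro x
    by_contra hne
    have hne' : C x * w' - w' * C x ≠ 0 := sub_ne_zero.2 hne
    have hPd : P (C x * w' - w' * C x) := by
      have := hP_add _ _ (hP_left x _ hw'P) (hP_right (-x) _ hw'P)
      rwa [C_neg, mul_neg, ← sub_eq_add_neg] at this
    refine hmin _ ⟨hne', hPd⟩ ?_
    change natDegree _ < natDegree w
    have hx0 : x ≠ 0 := by rintro rfl; simp at hne
    rw [← hw'deg, ← natDegree_C_mul (p := w') hx0]
    refine natDegree_lt_natDegree hne' (degree_sub_lt_left ?_ ?_ ?_)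
    · rw [degree_mul, degree_mul, add_comm]
    · exact mul_ne_zero (by simpa using hx0) hw'm.ne_zero
    · simp [leadingCoeff_mul, hw'm.leadingCoeff]
  have hlift : ∃ p : K[X], p.map (algebraMap K D) = w' := by
    have : w' ∈ Polynomial.lifts (algebraMap K D) := by
      rw [lifts_iff_coeff_lifts]
      intro n
      refine ⟨⟨w'.coeff n, Subring.mem_center_iff.2 fun x => ?_⟩, rfl⟩
      simpa using congrArg (fun r => coeff r n) (hcent x)
    exact (mem_lifts _).1 this
  obtain ⟨p, rfl⟩ := hlift
  -- The operator is now `d ↦ d * p(a)`, which is onto once `p(a) ≠ 0`; the degree of `p` is below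
  -- that of the minimal polynomial.
  have hpa : aeval a p ≠ 0 := by
    intro h0
    have hpm : p.Monic := by
      rwa [(algebraMap K D).injective.monic_map_iff]
    have := natDegree_le_natDegree (minpoly.min K a hpm h0)
    rw [← hf] at this
    rw [natDegree_map] at hw'deg
    omega
  obtain ⟨s, hs, hmem⟩ := hw'P
  refine .of_finite Z (fun htop => ha ?_) s hs ?_
  · rw [hK, Subring.mem_center_iff]
    intro g
    have : g ∈ Z := htop ▸ Subring.mem_top g
    rw [hZ, Subring.mem_centralizer_iff] at this
    exact (this a rfl).symm
  · rw [eq_top_iff]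
    intro d _
    have := hmem (d * (aeval a p)⁻¹)
    rwa [hφf, mul_assoc, inv_mul_cancel₀ hpa, mul_one] at this

/-! ### Fields -/

/-- A field algebraic over a unique factorization domain with a prime element `x` has a maximal
subring: it is generated by `x⁻¹` over a proper subring. -/
theorem HasMaximalSubring.of_prime {A F : Type*} [CommRing A] [IsDomain A]
    [UniqueFactorizationMonoid A] [Field F] [Algebra A F] [FaithfulSMul A F]
    [Algebra.IsAlgebraic A F] {x : A} (hx : Prime x) : HasMaximalSubring F := by
  have hinj : Function.Injective (algebraMap A F) := FaithfulSMul.algebraMap_injective A F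
  have hx0 : algebraMap A F x ≠ 0 := (map_ne_zero_iff _ hinj).2 hx.ne_zero
  -- The integral closure in `F` of the localization of `A` at the prime `(x)`.
  let R : Subring F :=
    { carrier := {t | ∃ g : A, ¬ x ∣ g ∧ IsIntegral A (g • t)}
      mul_mem' := by
        rintro s t ⟨g, hg, hs⟩ ⟨h, hh, ht⟩
        refine ⟨g * h, hx.not_dvd_mul hg hh, ?_⟩
        rw [← smul_mul_smul_comm]
        exact hs.mul ht
      one_mem' := ⟨1, hx.not_dvd_one, by simpa using isIntegral_one⟩
      add_mem' := by
        rintro s t ⟨g, hg, hs⟩ ⟨h, hh, ht⟩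
        refine ⟨g * h, hx.not_dvd_mul hg hh, ?_⟩
        have : (g * h) • (s + t) = h • (g • s) + g • (h • t) := by
          rw [smul_add, smul_smul, smul_smul, mul_comm h g]
        rw [this]
        exact (hs.smul h).add (ht.smul g)
      zero_mem' := ⟨1, hx.not_dvd_one, by simpa using isIntegral_zero⟩
      neg_mem' := by
        rintro s ⟨g, hg, hs⟩
        exact ⟨g, hg, by simpa using hs.neg⟩ }
  refine .of_finite R (fun htop => ?_) {(algebraMap A F x)⁻¹} (Set.finite_singleton _) ?_
  · obtain ⟨g, hg, hint⟩ : (algebraMap A F x)⁻¹ ∈ R := htop ▸ Subring.mem_top _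
    let := FractionRing.liftAlgebra A F
    have hy : algebraMap (FractionRing A) F
        (algebraMap A (FractionRing A) g * (algebraMap A (FractionRing A) x)⁻¹) =
        g • (algebraMap A F x)⁻¹ := by
      rw [map_mul, map_inv₀, ← IsScalarTower.algebraMap_apply, ← IsScalarTower.algebraMap_apply,
        Algebra.smul_def]
    rw [← hy, isIntegral_algebraMap_iff (algebraMap (FractionRing A) F).injective] at hint
    obtain ⟨c, hc⟩ := IsIntegrallyClosed.algebraMap_eq_of_integral hint
    have hx1 : algebraMap A (FractionRing A) x ≠ 0 :=
      (map_ne_zero_iff _ (IsFractionRing.injective A (FractionRing A))).2 hx.ne_zero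
    rw [eq_mul_inv_iff_mul_eq₀ hx1, ← map_mul] at hc
    exact hg ⟨c, by rw [mul_comm, IsFractionRing.injective A (FractionRing A) hc]⟩
  · rw [eq_top_iff]
    intro t _
    obtain ⟨f, hf0, hf⟩ := (Algebra.IsAlgebraic.isAlgebraic (R := A) t).exists_integral_multiple
    obtain ⟨k, g, rfl, hg⟩ : ∃ k g, f = x ^ k * g ∧ ¬ x ∣ g :=
      ⟨_, (FiniteMultiplicity.of_prime_left hx hf0).exists_eq_pow_mul_and_not_dvd⟩
    have hmem : x ^ k • t ∈ R := ⟨g, hg, by rwa [smul_smul, mul_comm]⟩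
    have ht : t = x ^ k • t * ((algebraMap A F x)⁻¹) ^ k := by
      rw [Algebra.smul_def, map_pow, mul_comm _ t, mul_assoc, ← mul_pow, mul_inv_cancel₀ hx0,
        one_pow, mul_one]
    rw [ht]
    have h1 : x ^ k • t ∈ Subring.closure ((R : Set F) ∪ {(algebraMap A F x)⁻¹}) :=
      Subring.subset_closure (Or.inl hmem)
    have h2 : (algebraMap A F x)⁻¹ ∈ Subring.closure ((R : Set F) ∪ {(algebraMap A F x)⁻¹}) :=
      Subring.subset_closure (Or.inr rfl)
    exact Subring.mul_mem _ h1 (Subring.pow_mem _ h2 k)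

theorem HasMaximalSubring.of_isTranscendenceBasis {k F ι : Type*} [CommRing k] [IsDomain k]
    [UniqueFactorizationMonoid k] [Field F] [Algebra k F] {b : ι → F}
    (hb : IsTranscendenceBasis k b) {x : MvPolynomial ι k} (hx : Prime x) :
    HasMaximalSubring F := by
  let e := hb.1.aevalEquiv
  have : UniqueFactorizationMonoid (Algebra.adjoin k (Set.range b)) :=
    e.toMulEquiv.uniqueFactorizationMonoid inferInstance
  have := hb.isAlgebraic
  exact .of_prime (A := Algebra.adjoin k (Set.range b)) (x := e x)
    ((MulEquiv.prime_iff e.toMulEquiv).2 hx)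

theorem exists_pow_eq_one_of_isAlgebraic_zmod {p : ℕ} [Fact p.Prime] {F : Type*} [Field F]
    [Algebra (ZMod p) F] {a : F} (ha : a ≠ 0) (h : IsAlgebraic (ZMod p) a) :
    ∃ n, 0 < n ∧ a ^ n = 1 := by
  have := IntermediateField.adjoin.finiteDimensional h.isIntegral
  have : Finite (IntermediateField.adjoin (ZMod p) {a}) := Module.finite_of_finite (ZMod p)
  let := Fintype.ofFinite (IntermediateField.adjoin (ZMod p) {a})
  let a' : IntermediateField.adjoin (ZMod p) {a} :=
    ⟨a, IntermediateField.mem_adjoin_simple_self (ZMod p) a⟩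
  have ha' : a' ≠ 0 := fun h0 => ha (congrArg Subtype.val h0)
  refine ⟨_, Nat.sub_pos_of_lt Fintype.one_lt_card,
    congrArg Subtype.val (FiniteField.pow_card_sub_one_eq_one a' ha')⟩

/-- A field with a unit of infinite order has a maximal subring. -/
theorem HasMaximalSubring.of_pow_ne_one {F : Type*} [Field F] {a : F} (ha : a ≠ 0)
    (h : ∀ n, 0 < n → a ^ n ≠ 1) : HasMaximalSubring F := by
  obtain ⟨p, hp⟩ := CharP.exists F
  rcases CharP.char_is_prime_or_zero F p with hpp | rfl
  · have : Fact p.Prime := ⟨hpp⟩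
    let := ZMod.algebra F p
    obtain ⟨ι, b, hb⟩ := exists_isTranscendenceBasis' (ZMod p) F
    have hne : Nonempty ι := by
      rw [hb.nonempty_iff_transcendental]
      refine ⟨⟨a, fun halg => ?_⟩⟩
      obtain ⟨n, hn, h1⟩ := exists_pow_eq_one_of_isAlgebraic_zmod ha halg
      exact h n hn h1
    obtain ⟨i⟩ := hne
    exact .of_isTranscendenceBasis hb (MvPolynomial.X_prime (i := i))
  · have : CharZero F := CharP.charP_to_charZero F
    -- Working over `ℤ` rather than `ℚ` supplies the prime 2 even when the basis is empty.
    obtain ⟨ι, b, hb⟩ := exists_isTranscendenceBasis' ℤ F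
    exact .of_isTranscendenceBasis hb
      ((MvPolynomial.prime_C_iff ι).2 Int.prime_two)

/-! ### Products of nonisomorphic fields -/

/-- An infinite product of pairwise nonisomorphic fields has a maximal subring. -/
theorem HasMaximalSubring.pi_of_field {I : Type*} [Infinite I] (K : I → Type*)
    [∀ i, Field (K i)] (hK : ∀ i j, Nonempty (K i ≃+* K j) → i = j) :
    HasMaximalSubring (∀ i, K i) := by
  -- A field whose nonzero elements all satisfy `x ^ N = 1` has at most `N + 1` elements, and finite
  -- fields of equal size are isomorphic.
  have hlarge : ∀ N, 0 < N → {i | ∃ x : K i, x ≠ 0 ∧ x ^ N ≠ 1}.Infinite := by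
    intro N hN hfin
    have hcard : ∀ i ∈ {i | ∃ x : K i, x ≠ 0 ∧ x ^ N ≠ 1}ᶜ,
        Finite (K i) ∧ Nat.card (K i) ≤ N + 1 := by
      intro i hi
      simp only [Set.mem_compl_iff, Set.mem_ofPred_eq, not_exists, not_and, not_not] at hi
      classical
      have hsub : (Set.univ : Set (K i)) ⊆
          (insert 0 (Polynomial.nthRoots N (1 : K i)).toFinset : Finset (K i)) := by
        intro x _
        by_cases hx : x = 0
        · simp [hx]
        · simp [Polynomial.mem_nthRoots hN, hi x hx]
      have hf : Finite (K i) := Set.finite_univ_iff.1 ((Finset.finite_toSet _).subset hsub)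
      refine ⟨hf, ?_⟩
      rw [← Set.ncard_univ]
      refine (Set.ncard_le_ncard hsub (Finset.finite_toSet _)).trans ?_
      rw [Set.ncard_coe_finset]
      refine (Finset.card_insert_le _ _).trans (Nat.succ_le_succ ?_)
      exact (Multiset.toFinset_card_le _).trans (Polynomial.card_nthRoots N 1)
    obtain ⟨i, hi, j, hj, hij, heq⟩ := hfin.infinite_compl.exists_ne_map_eq_of_mapsTo
      (f := fun i => Nat.card (K i)) (t := Set.Iic (N + 1)) (fun i hi => (hcard i hi).2)
      (Set.finite_Iic _)
    have := (hcard i hi).1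
    have := (hcard j hj).1
    let := Fintype.ofFinite (K i)
    let := Fintype.ofFinite (K j)
    exact hij (hK i j ⟨FiniteField.ringEquivOfCardEq (by
      simpa only [Nat.card_eq_fintype_card] using heq)⟩)
  obtain ⟨a, ha0, ha⟩ : ∃ a : ∀ i, K i, (∀ i, a i ≠ 0) ∧ ∀ N, 0 < N → ∃ i, a i ^ N ≠ 1 := by
    -- distinct indices, one for each factorial
    have hex : ∃ u : ℕ → I, Function.Injective u ∧
        ∀ n, ∃ x : K (u n), x ≠ 0 ∧ x ^ n.factorial ≠ 1 := by
      choose g hg using fun (n : ℕ) (s : Finset I) =>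
        (hlarge n.factorial n.factorial_pos).exists_notMem_finset s
      classical
      have hg1 : ∀ n (s : Finset I), ∃ x : K (g n s), x ≠ 0 ∧ x ^ n.factorial ≠ 1 :=
        fun n s => (hg n s).1
      -- `S n` holds the indices chosen before stage `n`, which the next choice avoids.
      let S : ℕ → Finset I := fun n => Nat.rec ∅ (fun n s => insert (g n s) s) n
      have hS : ∀ n, S (n + 1) = insert (g n (S n)) (S n) := fun _ => rfl
      have hmono : Monotone S := monotone_nat_of_le_succ fun n => by
        rw [hS]; exact Finset.subset_insert _ _
      refine ⟨fun n => g n (S n), ?_, fun n => hg1 _ _⟩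
      refine Function.Injective.of_lt_imp_ne fun m n hmn heq => (hg n (S n)).2 ?_
      rw [← heq]
      exact hmono (Nat.succ_le_of_lt hmn) (hS m ▸ Finset.mem_insert_self _ _)
    obtain ⟨u, hu, hux⟩ := hex
    have hch : ∀ i, ∃ x : K i, x ≠ 0 ∧ ∀ n, u n = i → x ^ n.factorial ≠ 1 := by
      intro i
      by_cases h : ∃ n, u n = i
      · obtain ⟨n, rfl⟩ := h
        obtain ⟨x, hx0, hx⟩ := hux n
        exact ⟨x, hx0, fun m hm => hu hm ▸ hx⟩
      · exact ⟨1, one_ne_zero, fun n hn => (h ⟨n, hn⟩).elim⟩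
    choose a ha0 ha using hch
    refine ⟨a, ha0, fun N hN => ⟨u N, fun h1 => ha (u N) N rfl ?_⟩⟩
    obtain ⟨c, hc⟩ := Nat.dvd_factorial hN le_rfl
    rw [hc, pow_mul, h1, one_pow]
  -- a prime ideal avoiding all `a ^ n - 1`
  have hclos : ∀ z ∈ Submonoid.closure {z : ∀ i, K i | ∃ n, 0 < n ∧ z = a ^ n - 1},
      ∃ n, 0 < n ∧ ∀ i, a i ^ n ≠ 1 → z i ≠ 0 := by
    intro z hz
    induction hz using Submonoid.closure_induction with
    | mem z hz =>
      obtain ⟨n, hn, rfl⟩ := hz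
      exact ⟨n, hn, fun i hi => sub_ne_zero.2 hi⟩
    | one => exact ⟨1, one_pos, fun i _ => one_ne_zero⟩
    | mul y z _ _ hy hz =>
      obtain ⟨n, hn, hy⟩ := hy
      obtain ⟨m, hm, hz⟩ := hz
      refine ⟨n * m, Nat.mul_pos hn hm, fun i hi => mul_ne_zero (hy i fun h => hi ?_)
        (hz i fun h => hi ?_)⟩
      · rw [pow_mul, h, one_pow]
      · rw [mul_comm, pow_mul, h, one_pow]
  obtain ⟨P, hP, -, hdisj⟩ := Ideal.exists_le_prime_disjoint (⊥ : Ideal (∀ i, K i))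
    (Submonoid.closure {z | ∃ n, 0 < n ∧ z = a ^ n - 1}) (by
      rw [Set.disjoint_left]
      rintro z hz hz'
      obtain ⟨n, hn, h⟩ := hclos z hz'
      obtain ⟨i, hi⟩ := ha n hn
      exact h i hi (congrFun (Ideal.mem_bot.1 hz) i))
  -- A product of fields is von Neumann regular, so its primes are maximal.
  have hmax : P.IsMaximal := by
    refine Ideal.Quotient.maximal_of_isField _ ⟨⟨0, 1, ?_⟩, mul_comm, fun {z} hz => ?_⟩
    · exact zero_ne_one
    · obtain ⟨t, rfl⟩ := Ideal.Quotient.mk_surjective z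
      refine ⟨Ideal.Quotient.mk P (fun i => (t i)⁻¹), ?_⟩
      have hmem : t * (t * (fun i => (t i)⁻¹) - 1) ∈ P := by
        convert P.zero_mem
        funext i
        by_cases hi : t i = 0
        · simp [hi]
        · simp [hi]
      rcases hP.mem_or_mem hmem with h | h
      · exact (hz (Ideal.Quotient.eq_zero_iff_mem.2 h)).elim
      · rw [← map_mul, ← map_one (Ideal.Quotient.mk P)]
        exact Ideal.Quotient.eq.2 h
  let := Ideal.Quotient.field P
  have hau : IsUnit a := isUnit_iff_exists.2 ⟨fun i => (a i)⁻¹,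
    funext fun i => mul_inv_cancel₀ (ha0 i), funext fun i => inv_mul_cancel₀ (ha0 i)⟩
  have hF : HasMaximalSubring ((∀ i, K i) ⧸ P) := by
    refine .of_pow_ne_one (a := Ideal.Quotient.mk P a) (hau.map _).ne_zero fun n hn h1 => ?_
    rw [← map_pow, ← map_one (Ideal.Quotient.mk P), Ideal.Quotient.eq] at h1
    exact Set.disjoint_left.1 hdisj h1 (Submonoid.subset_closure ⟨n, hn, rfl⟩)
  exact .of_surjective (Ideal.Quotient.mk P) Ideal.Quotient.mk_surjective hF

/-! ### Integrality over the center and the final case analysis -/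

theorem IsIntegralOverCenter.of_surjective {T S : Type*} [Ring T] [Ring S] (f : T →+* S)
    (hf : Function.Surjective f) (h : IsIntegralOverCenter T) : IsIntegralOverCenter S := by
  intro s
  obtain ⟨t, rfl⟩ := hf s
  obtain ⟨p, hp, hpt⟩ := h t
  let g : Subring.center T →+* Subring.center S :=
    (f.comp (Subring.center T).subtype).codRestrict (Subring.center S) fun c => by
      rw [Subring.mem_center_iff]
      intro s
      obtain ⟨u, rfl⟩ := hf s
      simpa using congrArg f (Subring.mem_center_iff.1 c.2 u)
  refine ⟨p.map g, hp.map g, ?_⟩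
  have hg : (Subring.center S).subtype.comp g = f.comp (Subring.center T).subtype := rfl
  rw [Polynomial.eval₂_map, hg, ← Polynomial.hom_eval₂, hpt, map_zero]

/-- A simple ring integral over its center has a maximal subring unless it is a field. -/
theorem HasMaximalSubring.or_isField {S : Type*} [Ring S] [IsSimpleRing S]
    (h : IsIntegralOverCenter S) : HasMaximalSubring S ∨ IsField S := by
  by_cases hidem : ∃ e : S, IsIdempotentElem e ∧ e ≠ 0 ∧ e ≠ 1
  · obtain ⟨e, he, h0, h1⟩ := hidem
    exact Or.inl (.of_isIdempotentElem he h0 h1)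
  have hidem' : ∀ e : S, IsIdempotentElem e → e = 0 ∨ e = 1 := fun e he => by
    by_contra hne
    push Not at hne
    exact hidem ⟨e, he, hne⟩
  let _ : Field (Subring.center S) := (IsSimpleRing.isField_center S).toField
  have hunit : ∀ a : S, a ≠ 0 → IsUnit a := fun a ha =>
    IsSimpleRing.isUnit_of_isNilpotent_or_isUnit (fun b =>
      isNilpotent_or_isUnit_of_isAlgebraic (K := Subring.center S) hidem'
        (IsIntegral.isAlgebraic (R := Subring.center S) (h b))) ha
  by_cases hcomm : ∀ a : S, a ∈ Subring.center S
  · right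
    refine ⟨exists_pair_ne S, fun x y => (Subring.mem_center_iff.1 (hcomm y) x), fun {a} ha => ?_⟩
    obtain ⟨b, hb, -⟩ := isUnit_iff_exists.1 (hunit a ha)
    exact ⟨b, hb⟩
  · left
    push Not at hcomm
    obtain ⟨a, ha⟩ := hcomm
    let _ : DivisionRing S := DivisionRing.ofIsUnitOrEqZero fun a =>
      (em (a = 0)).symm.imp_left (hunit a)
    exact .of_not_mem_center ha (h a)

/-- An infinite product of nonzero rings integral over their centers has a maximal subring. -/
theorem HasMaximalSubring.pi {I : Type*} [Infinite I] (T : I → Type*) [∀ i, Ring (T i)]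
    [∀ i, Nontrivial (T i)] (h : ∀ i, IsIntegralOverCenter (T i)) :
    HasMaximalSubring (∀ i, T i) := by
  choose M hM hS using fun i => exists_isSimpleRing_quotient (T i)
  have hev : ∀ i, Function.Surjective (Pi.evalRingHom T i) := Function.surjective_eval
  have hmk : ∀ i, Function.Surjective (Ideal.Quotient.mk (M i)) :=
    fun i => Ideal.Quotient.mk_surjective
  by_cases hmax : ∃ i, HasMaximalSubring (T i ⧸ M i)
  · obtain ⟨i, hi⟩ := hmax
    exact .of_surjective ((Ideal.Quotient.mk (M i)).comp (Pi.evalRingHom T i))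
      ((hmk i).comp (hev i)) hi
  have hfield : ∀ i, IsField (T i ⧸ M i) := fun i =>
    (HasMaximalSubring.or_isField ((h i).of_surjective _ (hmk i))).resolve_left
      fun hi => hmax ⟨i, hi⟩
  by_cases hiso : ∃ i j, Nonempty ((T i ⧸ M i) ≃+* (T j ⧸ M j)) ∧ i ≠ j
  · obtain ⟨i, j, ⟨e⟩, hij⟩ := hiso
    -- Two isomorphic residue fields at distinct indices give a surjection onto a square.
    refine .of_surjective
      ((e.toRingHom.comp ((Ideal.Quotient.mk (M i)).comp (Pi.evalRingHom T i))).prod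
        ((Ideal.Quotient.mk (M j)).comp (Pi.evalRingHom T j))) ?_
      (hasMaximalSubring_prod_self (T j ⧸ M j))
    rintro ⟨x, y⟩
    obtain ⟨x', rfl⟩ := e.surjective x
    obtain ⟨s, rfl⟩ := hmk i x'
    obtain ⟨t, rfl⟩ := hmk j y
    classical
    refine ⟨Function.update (Function.update 0 i s) j t, ?_⟩
    simp [Function.update_of_ne hij]
  let _ : ∀ i, Field (T i ⧸ M i) := fun i => (hfield i).toField
  have hfin : HasMaximalSubring (∀ i, T i ⧸ M i) :=
    .pi_of_field (fun i => T i ⧸ M i) fun i j hij => by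
      by_contra hne
      exact hiso ⟨i, j, hij, hne⟩
  refine .of_surjective (RingHom.pi fun i => (Ideal.Quotient.mk (M i)).comp (Pi.evalRingHom T i))
    (fun y => ?_) hfin
  choose t ht using fun i => hmk i (y i)
  exact ⟨t, funext ht⟩

theorem theorem4p19 {I : Type*} [Infinite I] (T : I → Type*)
    [∀ i, Ring (T i)] [∀ i, Nontrivial (T i)] :
    ((∀ i, IsIntegralOverCenter (T i)) →
      ∃ R : Subring (∀ i, T i), IsMaximalSubring R) ∧
    (IsIntegralOverCenter (∀ i, T i) →
      ∃ R : Subring (∀ i, T i), IsMaximalSubring R) :=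
  ⟨HasMaximalSubring.pi T, fun h => HasMaximalSubring.pi T fun i =>
    h.of_surjective (Pi.evalRingHom T i) (Function.surjective_eval i)⟩
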